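/- Let $E$ be a locally compact Hausdorff space with a countable base, equipped with its Borel $\sigma$-algebra. A Feller--Dynkin semigroup on $E$ is a family $(\hat P_t)_{t\ge 0}$ of bounded linear operators on the Banach space $C_0(E)$ of real continuous functions vanishing at infinity (with the sup norm) such that $\hat P_0=\mathrm{id}$, $\hat P_{s+t}=\hat P_s\hat P_t$, $\lim_{t\downarrow 0}\|\hat P_tf-f\|=0$ for every $f\in C_0(E)$, and $0\le f\le 1$ implies $0\le \hat P_tf\le 1$. It is honest if its representing kernels $P_t$, characterised by $\hat P_tf(x)=\int f(y)\,P_t(x,\mathrm dy)$ for $f \in C_0(E)$, are Markov kernels, i.e. $P_t(x,E)=1$ for all $t\ge 0$, $x\in E$. Let $\Omega$ be the space of continuous functions $\omega:[0,\infty)\to E$ with the topology of uniform convergence on compact sets (the compact-open topology) and the $\sigma$-algebra generated by the coordinate maps $X_t(\omega)=\omega(t)$. A diffusion on $E$ is given by an honest Feller--Dynkin semigroup together with probability measures $(\mathbb P^x)_{x\in E}$ on $\Omega$ such that * for all $x\in E$, $n\ge 0$, $0<t_1<\dots<t_n$ and Borel sets $C_0,\dots,C_n\subseteq E$, $$\mathbb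 P^x(X_0\in C_0,X_{t_1}\in C_1,\dots,X_{t_n}\in C_n)=\int_{C_0}\delta_x(\mathrm dx_0)\int_{C_1}P_{t_1}(x_0,\mathrm dx_1)\cdots\int_{C_n}P_{t_n-t_{n-1}}(x_{n-1},\mathrm dx_n);$$ * if $x_n\to x$ in $E$, then $\int f\,\mathrm d\mathbb P^{x_n}\to\int f\,\mathrm d\mathbb P^x$ for every bounded continuous $f:\Omega\to\mathbb R$. Let $\mathcal P$ be the set of lower semi-continuous pseudometrics $m:E\times E\to[0,1]$. For $0<c<1$ and $m\in\mathcal P$ put $U_c(m)(\omega,\omega')=\sup_{t\ge 0}c^t\,m(\omega(t),\omega'(t))$ for $\omega,\omega'\in\Omega$, and $$\mathcal G_c(m)(x,y)=\inf_{\gamma\in\Gamma(\mathbb P^x,\mathbb P^y)}\int U_c(m)\,\mathrm d\gamma ,\qquad x,y\in E,$$ where $\Gamma(\mathbb P^x,\mathbb P^y)$ is the set of probability measures on $\Omega\times\Omega$ with marginals $\mathbb P^x$ and $\mathbb P^y$. **Theorem.** Let a diffusion on $E$, a continuous function $obs:E\to[0,1]$ and $0<c<1$ be given. Define $d^c_0(x,y)=|obs(x)-obs(y)|$,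 $d^c_{n+1}=\mathcal G_c(d^c_n)$ for $n\ge 0$, and $\overline d^c=\sup_{n\in\mathbb N}d^c_n$. Then every $d_n^c$ and $\overline d^c$ belong to $\mathcal P$ (so that $\mathcal G_c$ is applied inside its domain), and $\overline d^c$ is a fixpoint of $\mathcal G_c$: $$\mathcal G_c(\overline d^c)=\overline d^c .$$ -/

import Mathlib

open MeasureTheory ProbabilityTheory Filter Topology
open scoped NNReal ENNReal ZeroAtInfty BoundedContinuousFunction

noncomputable section

namespace DiffusionMetric

/-! ### Feller-Dynkin semigroups and diffusions -/

/-- A Feller-Dynkin semigroup on `E`: a strongly continuous semigroup of bounded linear operators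
on `C₀(E, ℝ)` (with the sup norm) mapping functions with values in `[0,1]` to functions with
values in `[0,1]`. -/
structure FDSemigroup (E : Type*) [TopologicalSpace E] where
  /-- The operator at time `t`. -/
  op : ℝ≥0 → (C₀(E, ℝ) →L[ℝ] C₀(E, ℝ))
  op_zero : op 0 = ContinuousLinearMap.id ℝ C₀(E, ℝ)
  op_add : ∀ s t, op (s + t) = (op s).comp (op t)
  strongly_continuous : ∀ f : C₀(E, ℝ), Tendsto (fun t => ‖op t f - f‖) (𝓝[>] 0) (𝓝 0)
  sub_markov : ∀ (t : ℝ≥0) (f : C₀(E, ℝ)), (∀ x, 0 ≤ f x ∧ f x ≤ 1) →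
    ∀ x, 0 ≤ op t f x ∧ op t f x ≤ 1

/-- The space `Ω` of continuous trajectories `[0,∞) → E`. Its topology is Mathlib's topology on
`C(ℝ≥0, E)`, the compact-open topology. -/
abbrev Trajectory (E : Type*) [TopologicalSpace E] : Type _ := C(ℝ≥0, E)

/-- The `σ`-algebra on `Ω` generated by the coordinate maps `X_s(ω) = ω(s)`, `s ≥ 0`. -/
instance trajectoryMeasurableSpace (E : Type*) [TopologicalSpace E] [MeasurableSpace E] :
    MeasurableSpace (Trajectory E) :=
  ⨆ s : ℝ≥0, MeasurableSpace.comap (fun ω : Trajectory E => ω s) inferInstance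

/-- For `l = [(t₁, C₁), …, (tₙ, Cₙ)]`, the iterated integral
`∫_{C₁} P_{t₁ - s}(x, dx₁) ∫_{C₂} P_{t₂ - t₁}(x₁, dx₂) ⋯ ∫_{Cₙ} P_{tₙ - tₙ₋₁}(xₙ₋₁, dxₙ)`
(used for `s < t₁ < ⋯ < tₙ` only). -/
def cylinderMass {E : Type*} [MeasurableSpace E] (P : ℝ≥0 → Kernel E E) :
    ℝ≥0 → List (ℝ≥0 × Set E) → E → ℝ≥0∞
  | _, [], _ => 1
  | s, (t, C) :: l, x => ∫⁻ y in C, cylinderMass P t l y ∂(P (t - s) x)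

/-- `Q` is the law on trajectories of the Markov process with transition kernels `P` and initial
distribution `μ`: for all `0 < t₁ < ⋯ < tₙ` and all measurable `C₀, C₁, …, Cₙ`,
`Q(X_0 ∈ C₀, X_{t₁} ∈ C₁, …, X_{tₙ} ∈ Cₙ)
  = ∫_{C₀} μ(dx₀) ∫_{C₁} P_{t₁}(x₀, dx₁) ⋯ ∫_{Cₙ} P_{tₙ - tₙ₋₁}(xₙ₋₁, dxₙ)`. -/
def IsPathLaw {E : Type*} [TopologicalSpace E] [MeasurableSpace E] (P : ℝ≥0 → Kernel E E)
    (μ : Measure E) (Q : Measure (Trajectory E)) : Prop :=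
  ∀ (C₀ : Set E) (l : List (ℝ≥0 × Set E)), MeasurableSet C₀ → (∀ p ∈ l, MeasurableSet p.2) →
    List.Pairwise (· < ·) (0 :: l.map Prod.fst) →
    Q {ω | ω 0 ∈ C₀ ∧ ∀ p ∈ l, ω p.1 ∈ p.2} = ∫⁻ x in C₀, cylinderMass P 0 l x ∂μ

/-- A diffusion on `E`: an honest Feller-Dynkin process with continuous trajectories, whose laws
`ℙ^x` on the trajectory space depend weakly continuously on the starting point `x`. -/
structure Diffusion (E : Type*) [TopologicalSpace E] [MeasurableSpace E]
    extends FDSemigroup E where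
  /-- The family of kernels `P_t` representing the semigroup. -/
  kernel : ℝ≥0 → Kernel E E
  op_eq_integral : ∀ (t : ℝ≥0) (f : C₀(E, ℝ)) (x : E), op t f x = ∫ y, f y ∂(kernel t x)
  /-- The semigroup is honest: `P_t(x, E) = 1`. -/
  honest : ∀ t, IsMarkovKernel (kernel t)
  /-- The law `ℙ^x` of the process started at `x`. -/
  law : E → Measure (Trajectory E)
  law_isProbabilityMeasure : ∀ x, IsProbabilityMeasure (law x)
  law_isPathLaw : ∀ x, IsPathLaw kernel (Measure.dirac x) (law x)
  law_weakly_continuous : ∀ (u : ℕ → E) (x : E), Tendsto u atTop (𝓝 x) →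
    ∀ f : Trajectory E →ᵇ ℝ,
      Tendsto (fun n => ∫ ω, f ω ∂(law (u n))) atTop (𝓝 (∫ ω, f ω ∂(law x)))

/-! ### Pseudometrics, couplings, optimal transport -/

/-- `m` belongs to the lattice `𝒫` of lower semi-continuous `1`-bounded pseudometrics on `E`. -/
structure IsLSCPseudometric {E : Type*} [TopologicalSpace E] (m : E → E → ℝ) : Prop where
  self : ∀ x, m x x = 0
  nonneg : ∀ x y, 0 ≤ m x y
  symm : ∀ x y, m x y = m y x
  triangle : ∀ x y z, m x z ≤ m x y + m y z
  le_one : ∀ x y, m x y ≤ 1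
  lowerSemicontinuous : LowerSemicontinuous (fun p : E × E => m p.1 p.2)

/-- The set `Γ(μ, ν)` of couplings: probability measures on the product with marginals `μ`, `ν`. -/
def couplings {X Y : Type*} [MeasurableSpace X] [MeasurableSpace Y]
    (μ : Measure X) (ν : Measure Y) : Set (Measure (X × Y)) :=
  {γ | IsProbabilityMeasure γ ∧ γ.map Prod.fst = μ ∧ γ.map Prod.snd = ν}

/-- The optimal transport cost `W(k)(μ, ν) = inf_{γ ∈ Γ(μ, ν)} ∫ k dγ` for a nonnegative bounded
cost function `k`. -/
def transportCost {X : Type*} [MeasurableSpace X] (k : X → X → ℝ) (μ ν : Measure X) : ℝ :=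
  (⨅ γ ∈ couplings μ ν, ∫⁻ p, ENNReal.ofReal (k p.1 p.2) ∂γ).toReal

/-- The discounted uniform pseudometric
`U_c(m)(ω, ω') = sup_{t ≥ 0} c^t m(ω(t), ω'(t))` on trajectories. -/
def discountedUniform {E : Type*} [TopologicalSpace E] (c : ℝ) (m : E → E → ℝ)
    (ω ω' : Trajectory E) : ℝ :=
  ⨆ t : ℝ≥0, c ^ (t : ℝ) * m (ω t) (ω' t)

/-- The functional `𝒢_c(m)(x, y) = W(U_c(m))(ℙ^x, ℙ^y)`. -/
def Diffusion.G {E : Type*} [TopologicalSpace E] [MeasurableSpace E] (D : Diffusion E) (c : ℝ)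
    (m : E → E → ℝ) (x y : E) : ℝ :=
  transportCost (discountedUniform c m) (D.law x) (D.law y)

/-- The sequence `d_0(x, y) = |obs x - obs y|`, `d_{n+1} = 𝒢_c(d_n)`. -/
def Diffusion.d {E : Type*} [TopologicalSpace E] [MeasurableSpace E] (D : Diffusion E)
    (obs : E → ℝ) (c : ℝ) : ℕ → E → E → ℝ
  | 0 => fun x y => |obs x - obs y|
  | n + 1 => D.G c (D.d obs c n)

/-- The pseudometric `d̄^c = sup_n d_n`. -/
def Diffusion.dBar {E : Type*} [TopologicalSpace E] [MeasurableSpace E] (D : Diffusion E)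
    (obs : E → ℝ) (c : ℝ) (x y : E) : ℝ :=
  ⨆ n : ℕ, D.d obs c n x y

end DiffusionMetric

end

/-!
The marginal map `γ ↦ (μ, ν)` from probability measures on a product of Polish spaces to pairs of
probability measures is proper: by the theorem of Prokhorov compactness is tightness, and measures
on a product are tight as soon as their marginals are. The couplings of `μ` and `ν` form a fibre of
this map and `γ ↦ ∫ k dγ` is lower semicontinuous for lower semicontinuous `k`. Hence minimizing
over the fibre gives a lower semicontinuous function of `(μ, ν)`, and by the argument of Dini on
the compact fibre the minimum commutes with increasing suprema of `k`. Weak continuity of `x ↦ ℙ^x`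
turns this into: `𝒢_c` preserves `𝒫` and commutes with increasing suprema. As `ℙ^x`-almost every
path starts at `x`, the time `t = 0` in `U_c` shows `m ≤ 𝒢_c m`. So `d_n` increases, and
`𝒢_c (sup d_n) = sup 𝒢_c d_n = sup d_{n+1} = sup d_n`.
-/

namespace DiffusionMetric

section Semicontinuity

variable {X α : Type*} [TopologicalSpace X] [CompleteLinearOrder α] [DenselyOrdered α]

theorem lowerSemicontinuous_biInf_fiber {Y : Type*} [TopologicalSpace Y] {f : X → Y} {g : X → α}
    (hf : IsClosedMap f) (hg : LowerSemicontinuous g) :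
    LowerSemicontinuous fun y => ⨅ (x) (_ : f x = y), g x := by
  intro y a ha
  obtain ⟨b, hab, hb⟩ := exists_between ha
  have hopen : IsOpen (f '' {x | g x ≤ b})ᶜ := (hf _ (hg.isClosed_preimage b)).isOpen_compl
  have hy : y ∈ (f '' {x | g x ≤ b})ᶜ := by
    rintro ⟨x, hx, hxy⟩
    exact (hb.trans_le (iInf₂_le x hxy)).not_ge hx
  filter_upwards [hopen.mem_nhds hy] with z hz
  exact hab.trans_le <| le_iInf₂ fun x hxz => le_of_not_ge fun hx => hz ⟨x, hx, hxz⟩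

theorem biInf_iSup_eq_iSup_biInf_of_isCompact {ι : Type*} [Preorder ι] [IsDirectedOrder ι]
    [Nonempty ι] {g : ι → X → α} {K : Set X} (hK : IsCompact K)
    (hg : ∀ i, LowerSemicontinuous (g i)) (hmono : Monotone g) :
    ⨅ x ∈ K, ⨆ i, g i x = ⨆ i, ⨅ x ∈ K, g i x := by
  refine le_antisymm (le_of_forall_lt fun a ha => ?_)
    (iSup_le fun i => iInf₂_mono fun x _ => le_iSup (fun i => g i x) i)
  obtain ⟨b, hab, hb⟩ := exists_between ha
  -- As in the theorem of Dini, one of the increasing open sets `{b < g i}` contains `K`.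
  have hcover : K ⊆ ⋃ i, {x | b < g i x} := fun x hx =>
    Set.mem_iUnion.2 <| lt_iSup_iff.1 <| hb.trans_le (iInf₂_le x hx)
  have hdir : Directed (· ⊆ ·) fun i => {x | b < g i x} :=
    Monotone.directed_le fun _ _ hij x hx => lt_of_lt_of_le hx (hmono hij x)
  obtain ⟨i, hi⟩ := hK.elim_directed_cover _ (fun i => (hg i).isOpen_preimage b) hcover hdir
  exact hab.trans_le <| le_iSup_of_le i <| le_iInf₂ fun x hx => (hi hx).le

theorem lowerSemicontinuous_toReal {f : X → ℝ≥0∞} (hf : LowerSemicontinuous f)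
    (hfin : ∀ x, f x ≠ ∞) : LowerSemicontinuous fun x => (f x).toReal := by
  intro x a ha
  obtain ha0 | ha0 := lt_or_ge a 0
  · exact Eventually.of_forall fun y => ha0.trans_le ENNReal.toReal_nonneg
  · filter_upwards [hf x _ ((ENNReal.ofReal_lt_iff_lt_toReal ha0 (hfin x)).2 ha)] with y hy
    exact (ENNReal.ofReal_lt_iff_lt_toReal ha0 (hfin y)).1 hy

end Semicontinuity

section Polish

open TopologicalSpace

theorem isOpen_range_of_isDenseEmbedding {X Y : Type*} [TopologicalSpace X] [TopologicalSpace Y]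
    [WeaklyLocallyCompactSpace X] [T2Space Y] {i : X → Y} (hi : IsDenseEmbedding i) :
    IsOpen (Set.range i) := by
  rw [isOpen_iff_mem_nhds]
  rintro _ ⟨x, rfl⟩
  obtain ⟨K, hK, hxK⟩ := exists_compact_mem_nhds x
  have hclosed : IsClosed (i '' K) := (hK.image hi.continuous).isClosed
  refine mem_of_superset (hi.isDenseInducing.closure_image_mem_nhds hxK) ?_
  exact hclosed.closure_eq.trans_subset (Set.image_subset_range i K)

theorem polishSpace_of_weaklyLocallyCompactSpace (X : Type*) [TopologicalSpace X]
    [WeaklyLocallyCompactSpace X] [T2Space X] [SecondCountableTopology X] : PolishSpace X := by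
  let : MetricSpace X := metrizableSpaceMetric X
  have hi : IsDenseEmbedding ((↑) : X → UniformSpace.Completion X) :=
    UniformSpace.Completion.isDenseEmbedding_coe
  have : SecondCountableTopology (UniformSpace.Completion X) :=
    UniformSpace.secondCountable_of_separable _
  have : PolishSpace (Set.range ((↑) : X → UniformSpace.Completion X)) :=
    (isOpen_range_of_isDenseEmbedding hi).polishSpace
  exact hi.isEmbedding.toHomeomorph.isClosedEmbedding.polishSpace

theorem polishSpace_continuousMap (X Y : Type*) [TopologicalSpace X] [SecondCountableTopology X]
    [LocallyCompactSpace X] [TopologicalSpace Y] [PolishSpace Y] : PolishSpace C(X, Y) := by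
  let := upgradeIsCompletelyMetrizable Y
  infer_instance

theorem borel_continuousMap_eq_iSup_comap_eval (X Y : Type*) [TopologicalSpace X]
    [SecondCountableTopology X] [LocallyCompactSpace X] [TopologicalSpace Y] [PolishSpace Y]
    [MeasurableSpace Y] [BorelSpace Y] :
    borel C(X, Y) = ⨆ x, MeasurableSpace.comap (fun f : C(X, Y) => f x) inferInstance := by
  have := polishSpace_continuousMap X Y
  borelize C(X, Y)
  refine le_antisymm ?_ (iSup_le fun x => (continuous_eval_const x).measurable.comap_le)
  obtain ⟨s, hs, hdense⟩ := exists_countable_dense X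
  have := hs.to_subtype
  let restrict : C(X, Y) → s → Y := fun f x => f x
  have hcont : Continuous restrict := continuous_pi fun x => continuous_eval_const (x : X)
  have hinj : Function.Injective restrict := fun f g hfg => DFunLike.coe_injective <|
    Continuous.ext_on hdense f.continuous g.continuous fun x hx => congrFun hfg ⟨x, hx⟩
  -- By the Lusin-Souslin theorem, a continuous injection of Polish spaces induces the Borel sets.
  refine (hcont.measurableEmbedding hinj).comap_eq.ge.trans ?_
  simp only [MeasurableSpace.pi, MeasurableSpace.comap_iSup, MeasurableSpace.comap_comp]
  exact iSup_le fun x => le_iSup_of_le (x : X) le_rfl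

theorem borelSpace_trajectory (E : Type*) [TopologicalSpace E] [PolishSpace E]
    [MeasurableSpace E] [BorelSpace E] : BorelSpace (Trajectory E) :=
  ⟨(borel_continuousMap_eq_iSup_comap_eval ℝ≥0 E).symm⟩

end Polish

section LowerSemicontinuousIntegrals

theorem volume_restrict_setOf_ofReal_lt (a : ℝ≥0∞) :
    (volume.restrict (Set.Ioi 0)) {t : ℝ | ENNReal.ofReal t < a} = a := by
  rw [Measure.restrict_apply (measurableSet_lt ENNReal.measurable_ofReal measurable_const)]
  obtain rfl | ha := eq_or_ne a ∞
  · simp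
  · have : {t : ℝ | ENNReal.ofReal t < a} ∩ Set.Ioi 0 = Set.Ioo 0 a.toReal := by
      ext t
      exact and_comm.trans <| and_congr_right fun ht => ENNReal.ofReal_lt_iff_lt_toReal ht.le ha
    rw [this, Real.volume_Ioo, sub_zero, ENNReal.ofReal_toReal ha]

theorem lintegral_eq_lintegral_measure_ofReal_lt {Y : Type*} [MeasurableSpace Y] (μ : Measure Y)
    [SFinite μ] {f : Y → ℝ≥0∞} (hf : Measurable f) :
    ∫⁻ y, f y ∂μ = ∫⁻ t in Set.Ioi (0 : ℝ), μ {y | ENNReal.ofReal t < f y} := by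
  have hs : MeasurableSet {p : Y × ℝ | ENNReal.ofReal p.2 < f p.1} :=
    measurableSet_lt measurable_snd.ennreal_ofReal (hf.comp measurable_fst)
  calc ∫⁻ y, f y ∂μ
      = ∫⁻ y, (volume.restrict (Set.Ioi 0)) {t : ℝ | ENNReal.ofReal t < f y} ∂μ := by
        simp only [volume_restrict_setOf_ofReal_lt]
    _ = (μ.prod (volume.restrict (Set.Ioi 0))) {p | ENNReal.ofReal p.2 < f p.1} :=
        (Measure.prod_apply hs).symm
    _ = ∫⁻ t in Set.Ioi (0 : ℝ), μ {y | ENNReal.ofReal t < f y} := Measure.prod_apply_symm hs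

theorem lowerSemicontinuous_lintegral {Y : Type*} [TopologicalSpace Y] [HasOuterApproxClosed Y]
    [MeasurableSpace Y] [BorelSpace Y] [FirstCountableTopology (ProbabilityMeasure Y)]
    {f : Y → ℝ≥0∞} (hf : LowerSemicontinuous f) :
    LowerSemicontinuous fun μ : ProbabilityMeasure Y => ∫⁻ y, f y ∂(μ : Measure Y) := by
  refine lowerSemicontinuous_iff_le_liminf.2 fun μ => ?_
  simp only [lintegral_eq_lintegral_measure_ofReal_lt _ hf.measurable]
  calc ∫⁻ t in Set.Ioi (0 : ℝ), (μ : Measure Y) {y | ENNReal.ofReal t < f y}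
      ≤ ∫⁻ t in Set.Ioi (0 : ℝ),
          liminf (fun ν : ProbabilityMeasure Y => (ν : Measure Y) {y | ENNReal.ofReal t < f y})
            (𝓝 μ) :=
        lintegral_mono fun t =>
          ProbabilityMeasure.le_liminf_measure_open_of_tendsto tendsto_id (hf.isOpen_preimage _)
    _ ≤ liminf (fun ν : ProbabilityMeasure Y =>
          ∫⁻ t in Set.Ioi (0 : ℝ), (ν : Measure Y) {y | ENNReal.ofReal t < f y}) (𝓝 μ) :=
        lintegral_liminf_le fun ν => Antitone.measurable fun _ _ hst => measure_mono fun _ hy =>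
          (ENNReal.ofReal_le_ofReal hst).trans_lt hy

end LowerSemicontinuousIntegrals

section Couplings

variable {X Y Z : Type*} [MeasurableSpace X] [MeasurableSpace Y] [MeasurableSpace Z]

theorem prod_mem_couplings (μ : Measure X) (ν : Measure Y) [IsProbabilityMeasure μ]
    [IsProbabilityMeasure ν] : μ.prod ν ∈ couplings μ ν :=
  ⟨inferInstance, by simp, by simp⟩

theorem map_diag_mem_couplings (μ : Measure X) [IsProbabilityMeasure μ] :
    μ.map (fun x => (x, x)) ∈ couplings μ μ := by
  have hdiag : Measurable fun x : X => (x, x) := measurable_id.prodMk measurable_id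
  refine ⟨Measure.isProbabilityMeasure_map hdiag.aemeasurable, ?_, ?_⟩
  · rw [Measure.map_map measurable_fst hdiag]
    exact Measure.map_id
  · rw [Measure.map_map measurable_snd hdiag]
    exact Measure.map_id

theorem map_swap_mem_couplings {μ : Measure X} {ν : Measure Y} {γ : Measure (X × Y)}
    (hγ : γ ∈ couplings μ ν) : γ.map Prod.swap ∈ couplings ν μ := by
  obtain ⟨_, hfst, hsnd⟩ := hγ
  refine ⟨Measure.isProbabilityMeasure_map measurable_swap.aemeasurable, ?_, ?_⟩
  · rw [Measure.map_map measurable_fst measurable_swap]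
    exact hsnd
  · rw [Measure.map_map measurable_snd measurable_swap]
    exact hfst

theorem exists_gluing [StandardBorelSpace Z] {μ : Measure X} {ν : Measure Y} {ρ : Measure Z}
    {γ : Measure (X × Y)} {η : Measure (Y × Z)} (hγ : γ ∈ couplings μ ν)
    (hη : η ∈ couplings ν ρ) :
    ∃ θ : Measure ((X × Y) × Z), IsProbabilityMeasure θ ∧ θ.map Prod.fst = γ ∧
      θ.map (fun p => (p.1.2, p.2)) = η := by
  obtain ⟨_, -, hγsnd⟩ := hγ
  obtain ⟨_, hηfst, -⟩ := hη
  have : Nonempty Z := (nonempty_of_isProbabilityMeasure η).map Prod.snd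
  have hproj : Measurable fun p : (X × Y) × Z => (p.1.2, p.2) := by fun_prop
  -- Draw `(x, y)` from `γ` and then `z` from the conditional law of `η` given `y`.
  refine ⟨γ ⊗ₘ (η.condKernel.comap Prod.snd measurable_snd), inferInstance,
    Measure.fst_compProd _ _, Measure.ext fun s hs => ?_⟩
  calc ((γ ⊗ₘ (η.condKernel.comap Prod.snd measurable_snd)).map fun p => (p.1.2, p.2)) s
      = ∫⁻ p, η.condKernel p.2 (Prod.mk p.2 ⁻¹' s) ∂γ := by
        rw [Measure.map_apply hproj hs, Measure.compProd_apply (hproj hs)]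
        rfl
    _ = ∫⁻ y, η.condKernel y (Prod.mk y ⁻¹' s) ∂η.fst := by
        rw [Measure.fst, hηfst, ← hγsnd,
          lintegral_map (Kernel.measurable_kernel_prodMk_left hs) measurable_snd]
    _ = η s := by rw [← Measure.compProd_apply hs, η.disintegrate]

theorem map_outer_mem_couplings {μ : Measure X} {ν ν' : Measure Y} {ρ : Measure Z}
    {θ : Measure ((X × Y) × Z)} [IsProbabilityMeasure θ]
    (hfst : θ.map Prod.fst ∈ couplings μ ν)
    (hsnd : θ.map (fun p => (p.1.2, p.2)) ∈ couplings ν' ρ) :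
    θ.map (fun p => (p.1.1, p.2)) ∈ couplings μ ρ := by
  have houter : Measurable fun p : (X × Y) × Z => (p.1.1, p.2) := by fun_prop
  have hinner : Measurable fun p : (X × Y) × Z => (p.1.2, p.2) := by fun_prop
  refine ⟨Measure.isProbabilityMeasure_map houter.aemeasurable, ?_, ?_⟩
  · rw [Measure.map_map measurable_fst houter, ← hfst.2.1,
      Measure.map_map measurable_fst measurable_fst]
    rfl
  · rw [Measure.map_map measurable_snd houter, ← hsnd.2.2, Measure.map_map measurable_snd hinner]
    rfl

end Couplings

section Marginals

variable {X Y : Type*} [TopologicalSpace X] [PolishSpace X] [MeasurableSpace X] [BorelSpace X]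
  [TopologicalSpace Y] [PolishSpace Y] [MeasurableSpace Y] [BorelSpace Y]

/-- The pair of marginals of a probability measure on a product; its fibres are the sets
`Γ(μ, ν)` of couplings. -/
noncomputable def marginals {X Y : Type*} [MeasurableSpace X] [MeasurableSpace Y]
    (γ : ProbabilityMeasure (X × Y)) : ProbabilityMeasure X × ProbabilityMeasure Y :=
  (γ.map measurable_fst.aemeasurable, γ.map measurable_snd.aemeasurable)

theorem marginals_eq_iff {X Y : Type*} [MeasurableSpace X] [MeasurableSpace Y]
    {γ : ProbabilityMeasure (X × Y)} {q : ProbabilityMeasure X × ProbabilityMeasure Y} :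
    marginals γ = q ↔ (γ : Measure (X × Y)) ∈ couplings (q.1 : Measure X) (q.2 : Measure Y) :=
  Prod.ext_iff.trans <| (and_congr Subtype.ext_iff Subtype.ext_iff).trans
    (and_iff_right γ.prop).symm

theorem isTightMeasureSet_coe_image_of_isCompact {S : Set (ProbabilityMeasure X)}
    (hS : IsCompact S) : IsTightMeasureSet ((↑) '' S : Set (Measure X)) := by
  let := TopologicalSpace.upgradeIsCompletelyMetrizable X
  exact isTightMeasureSet_of_isCompact_closure hS.closure

theorem isProperMap_marginals : IsProperMap (marginals (X := X) (Y := Y)) := by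
  have hcont : Continuous (marginals (X := X) (Y := Y)) :=
    (ProbabilityMeasure.continuous_map continuous_fst).prodMk
      (ProbabilityMeasure.continuous_map continuous_snd)
  refine isProperMap_iff_isCompact_preimage.2 ⟨hcont, fun K hK => ?_⟩
  have htight : IsTightMeasureSet ((↑) '' (marginals ⁻¹' K) : Set (Measure (X × Y))) := by
    refine IsTightMeasureSet.prodMk
      ((isTightMeasureSet_coe_image_of_isCompact (hK.image continuous_fst)).subset ?_)
      ((isTightMeasureSet_coe_image_of_isCompact (hK.image continuous_snd)).subset ?_)
    · rintro _ ⟨_, ⟨γ, hγ, rfl⟩, rfl⟩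
      exact ⟨(marginals γ).1, ⟨_, hγ, rfl⟩, rfl⟩
    · rintro _ ⟨_, ⟨γ, hγ, rfl⟩, rfl⟩
      exact ⟨(marginals γ).2, ⟨_, hγ, rfl⟩, rfl⟩
  exact (hK.isClosed.preimage hcont).closure_eq ▸ isCompact_closure_of_isTightMeasureSet htight

end Marginals

section ETransportCost

variable {X Y Z : Type*} [MeasurableSpace X] [MeasurableSpace Y] [MeasurableSpace Z]

/-- The optimal transport cost `inf_{γ ∈ Γ(μ, ν)} ∫ k dγ` of an extended nonnegative cost function
`k`, of which `transportCost` is the real-valued version. -/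
noncomputable def etransportCost (k : X × Y → ℝ≥0∞) (μ : Measure X) (ν : Measure Y) : ℝ≥0∞ :=
  ⨅ γ ∈ couplings μ ν, ∫⁻ p, k p ∂γ

theorem etransportCost_self {k : X × X → ℝ≥0∞} (hk : Measurable k) (hdiag : ∀ x, k (x, x) = 0)
    (μ : Measure X) [IsProbabilityMeasure μ] : etransportCost k μ μ = 0 := by
  refine le_antisymm ((iInf₂_le _ (map_diag_mem_couplings μ)).trans_eq ?_) zero_le
  rw [lintegral_map hk (by fun_prop)]
  simp only [hdiag, lintegral_zero]

theorem etransportCost_comp_swap (k : X × Y → ℝ≥0∞) (μ : Measure X) (ν : Measure Y) :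
    etransportCost (k ∘ Prod.swap) ν μ = etransportCost k μ ν := by
  refine le_antisymm (le_iInf₂ fun γ hγ => ?_) (le_iInf₂ fun γ hγ => ?_)
  · exact (iInf₂_le _ (map_swap_mem_couplings hγ)).trans_eq
      (lintegral_map_equiv _ MeasurableEquiv.prodComm)
  · exact (iInf₂_le _ (map_swap_mem_couplings hγ)).trans_eq
      (lintegral_map_equiv _ MeasurableEquiv.prodComm)

theorem etransportCost_triangle [StandardBorelSpace Z] {k₁ : X × Y → ℝ≥0∞} {k₂ : Y × Z → ℝ≥0∞}
    {k₃ : X × Z → ℝ≥0∞} (hk₁ : Measurable k₁) (hk₂ : Measurable k₂) (hk₃ : Measurable k₃)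
    (hk : ∀ x y z, k₃ (x, z) ≤ k₁ (x, y) + k₂ (y, z)) (μ : Measure X) (ν : Measure Y)
    (ρ : Measure Z) :
    etransportCost k₃ μ ρ ≤ etransportCost k₁ μ ν + etransportCost k₂ ν ρ := by
  unfold etransportCost
  simp only [ENNReal.iInf_add, ENNReal.add_iInf]
  refine le_iInf₂ fun η hη => le_iInf₂ fun γ hγ => ?_
  obtain ⟨θ, _, rfl, rfl⟩ := exists_gluing hγ hη
  have houter : Measurable fun p : (X × Y) × Z => (p.1.1, p.2) := by fun_prop
  have hinner : Measurable fun p : (X × Y) × Z => (p.1.2, p.2) := by fun_prop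
  calc ⨅ γ' ∈ couplings μ ρ, ∫⁻ p, k₃ p ∂γ'
      ≤ ∫⁻ p, k₃ p ∂(θ.map fun p => (p.1.1, p.2)) := iInf₂_le _ (map_outer_mem_couplings hγ hη)
    _ = ∫⁻ p, k₃ (p.1.1, p.2) ∂θ := lintegral_map hk₃ houter
    _ ≤ ∫⁻ p, k₁ p.1 + k₂ (p.1.2, p.2) ∂θ := lintegral_mono fun p => hk _ _ _
    _ = ∫⁻ p, k₁ p.1 ∂θ + ∫⁻ p, k₂ (p.1.2, p.2) ∂θ :=
        lintegral_add_left (hk₁.comp measurable_fst) _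
    _ = ∫⁻ p, k₁ p ∂(θ.map Prod.fst) + ∫⁻ p, k₂ p ∂(θ.map fun p => (p.1.2, p.2)) := by
        rw [lintegral_map hk₁ measurable_fst, lintegral_map hk₂ hinner]

theorem etransportCost_le_of_le {k : X × Y → ℝ≥0∞} {a : ℝ≥0∞} (hk : ∀ p, k p ≤ a) (μ : Measure X)
    (ν : Measure Y) [IsProbabilityMeasure μ] [IsProbabilityMeasure ν] :
    etransportCost k μ ν ≤ a :=
  calc etransportCost k μ ν ≤ ∫⁻ p, k p ∂(μ.prod ν) := iInf₂_le _ (prod_mem_couplings μ ν)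
    _ ≤ ∫⁻ _, a ∂(μ.prod ν) := lintegral_mono hk
    _ = a := by simp

theorem le_etransportCost_of_ae {k : X × Y → ℝ≥0∞} {μ : Measure X} {ν : Measure Y} {a : ℝ≥0∞}
    {s : Set X} {t : Set Y} (hs : ∀ᵐ x ∂μ, x ∈ s) (ht : ∀ᵐ y ∂ν, y ∈ t)
    (hk : ∀ x ∈ s, ∀ y ∈ t, a ≤ k (x, y)) : a ≤ etransportCost k μ ν := by
  refine le_iInf₂ fun γ ⟨_, hfst, hsnd⟩ => ?_
  have hs' : ∀ᵐ p ∂γ, p.1 ∈ s := ae_of_ae_map measurable_fst.aemeasurable (hfst ▸ hs)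
  have ht' : ∀ᵐ p ∂γ, p.2 ∈ t := ae_of_ae_map measurable_snd.aemeasurable (hsnd ▸ ht)
  calc a = ∫⁻ _, a ∂γ := by simp
    _ ≤ ∫⁻ p, k p ∂γ := lintegral_mono_ae <| by
      filter_upwards [hs', ht'] with p hp₁ hp₂ using hk _ hp₁ _ hp₂

theorem etransportCost_eq_biInf_marginals (k : X × Y → ℝ≥0∞)
    (q : ProbabilityMeasure X × ProbabilityMeasure Y) :
    etransportCost k q.1 q.2 =
      ⨅ (γ : ProbabilityMeasure (X × Y)) (_ : marginals γ = q), ∫⁻ p, k p ∂(γ : Measure (X × Y)) :=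
  le_antisymm (le_iInf₂ fun _ hγ => iInf₂_le _ (marginals_eq_iff.1 hγ))
    (le_iInf₂ fun γ hγ =>
      iInf₂_le (⟨γ, hγ.1⟩ : ProbabilityMeasure (X × Y)) (marginals_eq_iff.2 hγ))

variable [TopologicalSpace X] [PolishSpace X] [BorelSpace X]
  [TopologicalSpace Y] [PolishSpace Y] [BorelSpace Y]

theorem lowerSemicontinuous_etransportCost {k : X × Y → ℝ≥0∞} (hk : LowerSemicontinuous k) :
    LowerSemicontinuous fun q : ProbabilityMeasure X × ProbabilityMeasure Y =>
      etransportCost k q.1 q.2 := by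
  simp only [etransportCost_eq_biInf_marginals]
  exact lowerSemicontinuous_biInf_fiber isProperMap_marginals.isClosedMap
    (lowerSemicontinuous_lintegral hk)

theorem etransportCost_iSup {k : ℕ → X × Y → ℝ≥0∞} (hk : ∀ n, LowerSemicontinuous (k n))
    (hmono : Monotone k) (μ : ProbabilityMeasure X) (ν : ProbabilityMeasure Y) :
    etransportCost (fun p => ⨆ n, k n p) μ ν = ⨆ n, etransportCost (k n) μ ν := by
  have hcompact : IsCompact {γ : ProbabilityMeasure (X × Y) | marginals γ = (μ, ν)} :=
    isProperMap_marginals.isCompact_preimage isCompact_singleton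
  have hmono_lintegral : Monotone fun n (γ : ProbabilityMeasure (X × Y)) =>
      ∫⁻ p, k n p ∂(γ : Measure (X × Y)) := fun _ _ hij γ => lintegral_mono (hmono hij)
  simp only [etransportCost_eq_biInf_marginals _ (μ, ν),
    lintegral_iSup (fun n => (hk n).measurable) hmono]
  exact biInf_iSup_eq_iSup_biInf_of_isCompact hcompact
    (fun n => lowerSemicontinuous_lintegral (hk n)) hmono_lintegral

end ETransportCost

section LSCPseudometric

namespace IsLSCPseudometric

variable {X Y ι : Type*} [TopologicalSpace X] [TopologicalSpace Y] {m : X → X → ℝ}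
  {ms : ι → X → X → ℝ}

theorem comap (hm : IsLSCPseudometric m) {f : Y → X} (hf : Continuous f) :
    IsLSCPseudometric fun x y => m (f x) (f y) where
  self x := hm.self (f x)
  nonneg x y := hm.nonneg (f x) (f y)
  symm x y := hm.symm (f x) (f y)
  triangle x y z := hm.triangle (f x) (f y) (f z)
  le_one x y := hm.le_one (f x) (f y)
  lowerSemicontinuous := hm.lowerSemicontinuous.comp (hf.prodMap hf)

theorem const_mul (hm : IsLSCPseudometric m) {a : ℝ} (ha0 : 0 ≤ a) (ha1 : a ≤ 1) :
    IsLSCPseudometric fun x y => a * m x y where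
  self x := by rw [hm.self, mul_zero]
  nonneg x y := mul_nonneg ha0 (hm.nonneg x y)
  symm x y := by rw [hm.symm]
  triangle x y z := by
    rw [← mul_add]
    exact mul_le_mul_of_nonneg_left (hm.triangle x y z) ha0
  le_one x y := mul_le_one₀ ha1 (hm.nonneg x y) (hm.le_one x y)
  lowerSemicontinuous := (continuous_const_mul a).comp_lowerSemicontinuous
    hm.lowerSemicontinuous fun _ _ h => mul_le_mul_of_nonneg_left h ha0

theorem bddAbove_range (hms : ∀ i, IsLSCPseudometric (ms i)) (x y : X) :
    BddAbove (Set.range fun i => ms i x y) :=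
  ⟨1, Set.forall_mem_range.2 fun i => (hms i).le_one x y⟩

theorem iSup [Nonempty ι] (hms : ∀ i, IsLSCPseudometric (ms i)) :
    IsLSCPseudometric fun x y => ⨆ i, ms i x y where
  self x := by simp only [(hms _).self, ciSup_const]
  nonneg x y := Real.iSup_nonneg fun i => (hms i).nonneg x y
  symm x y := by simp only [(hms _).symm x y]
  triangle x y z := ciSup_le fun i => ((hms i).triangle x y z).trans <|
    add_le_add (le_ciSup (bddAbove_range hms x y) i) (le_ciSup (bddAbove_range hms y z) i)
  le_one x y := ciSup_le fun i => (hms i).le_one x y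
  lowerSemicontinuous := lowerSemicontinuous_ciSup (fun p => bddAbove_range hms p.1 p.2)
    fun i => (hms i).lowerSemicontinuous

theorem lowerSemicontinuous_ofReal (hm : IsLSCPseudometric m) :
    LowerSemicontinuous fun p : X × X => ENNReal.ofReal (m p.1 p.2) :=
  ENNReal.continuous_ofReal.comp_lowerSemicontinuous hm.lowerSemicontinuous
    fun _ _ => ENNReal.ofReal_le_ofReal

theorem etransportCost_ne_top [MeasurableSpace X] (hm : IsLSCPseudometric m) (μ ν : Measure X)
    [IsProbabilityMeasure μ] [IsProbabilityMeasure ν] :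
    etransportCost (fun p => ENNReal.ofReal (m p.1 p.2)) μ ν ≠ ∞ :=
  ne_top_of_le_ne_top ENNReal.one_ne_top <|
    etransportCost_le_of_le (fun p => ENNReal.ofReal_le_one.2 (hm.le_one p.1 p.2)) μ ν

variable [PolishSpace X] [MeasurableSpace X] [BorelSpace X]

protected theorem transportCost (hm : IsLSCPseudometric m) :
    IsLSCPseudometric fun μ ν : ProbabilityMeasure X => transportCost m μ ν where
  self μ := congrArg ENNReal.toReal <| etransportCost_self hm.lowerSemicontinuous_ofReal.measurable
    (fun x => by rw [hm.self, ENNReal.ofReal_zero]) μ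
  nonneg μ ν := ENNReal.toReal_nonneg
  symm μ ν := congrArg ENNReal.toReal <| (etransportCost_comp_swap _ _ _).symm.trans <|
    congrArg (etransportCost · _ _) <| funext fun _ => congrArg ENNReal.ofReal (hm.symm _ _)
  triangle μ ν ρ := by
    have hmeas := hm.lowerSemicontinuous_ofReal.measurable
    refine ENNReal.toReal_le_add (etransportCost_triangle hmeas hmeas hmeas (fun x y z => ?_) μ ν ρ)
      (hm.etransportCost_ne_top μ ν) (hm.etransportCost_ne_top ν ρ)
    rw [← ENNReal.ofReal_add (hm.nonneg x y) (hm.nonneg y z)]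
    exact ENNReal.ofReal_le_ofReal (hm.triangle x y z)
  le_one μ ν := ENNReal.toReal_le_of_le_ofReal zero_le_one <|
    etransportCost_le_of_le (fun p => ENNReal.ofReal_le_ofReal (hm.le_one p.1 p.2)) _ _
  lowerSemicontinuous := lowerSemicontinuous_toReal
    (lowerSemicontinuous_etransportCost hm.lowerSemicontinuous_ofReal)
    fun q => hm.etransportCost_ne_top q.1 q.2

theorem transportCost_iSup {ms : ℕ → X → X → ℝ} (hms : ∀ n, IsLSCPseudometric (ms n))
    (hmono : Monotone ms) (μ ν : ProbabilityMeasure X) :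
    transportCost (fun x y => ⨆ n, ms n x y) μ ν = ⨆ n, transportCost (ms n) μ ν := by
  have hofReal (p : X × X) :
      ENNReal.ofReal (⨆ n, ms n p.1 p.2) = ⨆ n, ENNReal.ofReal (ms n p.1 p.2) :=
    ENNReal.ofReal_mono.map_ciSup_of_continuousAt ENNReal.continuous_ofReal.continuousAt
      (bddAbove_range hms p.1 p.2)
  calc transportCost (fun x y => ⨆ n, ms n x y) μ ν
      = (etransportCost (fun p => ⨆ n, ENNReal.ofReal (ms n p.1 p.2)) μ ν).toReal := by
        simp only [← hofReal]
        rfl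
    _ = (⨆ n, etransportCost (fun p => ENNReal.ofReal (ms n p.1 p.2)) μ ν).toReal := by
        rw [etransportCost_iSup (fun n => (hms n).lowerSemicontinuous_ofReal)
          fun _ _ hij p => ENNReal.ofReal_le_ofReal (hmono hij p.1 p.2)]
    _ = ⨆ n, transportCost (ms n) μ ν :=
        ENNReal.toReal_iSup fun n => (hms n).etransportCost_ne_top μ ν

end IsLSCPseudometric

theorem isLSCPseudometric_abs_sub {X : Type*} [TopologicalSpace X] {f : X → ℝ} (hf : Continuous f)
    (hf01 : ∀ x, f x ∈ Set.Icc (0 : ℝ) 1) : IsLSCPseudometric fun x y => |f x - f y| where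
  self x := by rw [sub_self, abs_zero]
  nonneg x y := abs_nonneg _
  symm x y := abs_sub_comm _ _
  triangle x y z := abs_sub_le _ _ _
  le_one x y := abs_sub_le_of_nonneg_of_le (hf01 x).1 (hf01 x).2 (hf01 y).1 (hf01 y).2
  lowerSemicontinuous := Continuous.lowerSemicontinuous (by fun_prop)

end LSCPseudometric

section DiscountedUniform

variable {E : Type*} [TopologicalSpace E] {c : ℝ} {m : E → E → ℝ}

theorem IsLSCPseudometric.discount_mul_eval (hm : IsLSCPseudometric m) (hc0 : 0 ≤ c) (hc1 : c ≤ 1)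
    (t : ℝ≥0) :
    IsLSCPseudometric fun ω ω' : Trajectory E => c ^ (t : ℝ) * m (ω t) (ω' t) :=
  (hm.comap (continuous_eval_const t)).const_mul (Real.rpow_nonneg hc0 _)
    (Real.rpow_le_one hc0 hc1 t.coe_nonneg)

protected theorem IsLSCPseudometric.discountedUniform (hm : IsLSCPseudometric m) (hc0 : 0 ≤ c)
    (hc1 : c ≤ 1) : IsLSCPseudometric (discountedUniform c m) :=
  .iSup (hm.discount_mul_eval hc0 hc1)

theorem le_discountedUniform (hm : IsLSCPseudometric m) (hc0 : 0 ≤ c) (hc1 : c ≤ 1)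
    (ω ω' : Trajectory E) : m (ω 0) (ω' 0) ≤ discountedUniform c m ω ω' := by
  calc m (ω 0) (ω' 0) = c ^ ((0 : ℝ≥0) : ℝ) * m (ω 0) (ω' 0) := by
        rw [NNReal.coe_zero, Real.rpow_zero, one_mul]
    _ ≤ discountedUniform c m ω ω' :=
        le_ciSup (IsLSCPseudometric.bddAbove_range (hm.discount_mul_eval hc0 hc1) ω ω') 0

theorem discountedUniform_mono {m' : E → E → ℝ} (hm' : IsLSCPseudometric m') (hc0 : 0 ≤ c)
    (hc1 : c ≤ 1) (h : m ≤ m') :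
    (discountedUniform c m : Trajectory E → Trajectory E → ℝ) ≤ discountedUniform c m' :=
  fun ω ω' => ciSup_mono (IsLSCPseudometric.bddAbove_range (hm'.discount_mul_eval hc0 hc1) ω ω')
    fun _ => mul_le_mul_of_nonneg_left (h _ _) (Real.rpow_nonneg hc0 _)

theorem discountedUniform_iSup {ι : Type*} [Nonempty ι] {ms : ι → E → E → ℝ}
    (hms : ∀ i, IsLSCPseudometric (ms i)) (hc0 : 0 ≤ c) (hc1 : c ≤ 1) (ω ω' : Trajectory E) :
    discountedUniform c (fun x y => ⨆ i, ms i x y) ω ω' = ⨆ i, discountedUniform c (ms i) ω ω' := by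
  refine le_antisymm (ciSup_le fun t => ?_) (ciSup_le fun i => discountedUniform_mono
    (.iSup hms) hc0 hc1 (fun x y => le_ciSup (IsLSCPseudometric.bddAbove_range hms x y) i) ω ω')
  rw [Real.mul_iSup_of_nonneg (Real.rpow_nonneg hc0 _)]
  exact ciSup_mono
    (IsLSCPseudometric.bddAbove_range (fun i => (hms i).discountedUniform hc0 hc1) ω ω') fun i =>
      le_ciSup (IsLSCPseudometric.bddAbove_range ((hms i).discount_mul_eval hc0 hc1) ω ω') t

end DiscountedUniform

namespace Diffusion

variable {E : Type*} [TopologicalSpace E] [MeasurableSpace E] (D : Diffusion E)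

/-- The law `ℙ^x` as a point of the space of probability measures with its weak topology. -/
noncomputable def probLaw (x : E) : ProbabilityMeasure (Trajectory E) :=
  ⟨D.law x, D.law_isProbabilityMeasure x⟩

theorem continuous_probLaw [SequentialSpace E] [OpensMeasurableSpace (Trajectory E)] :
    Continuous D.probLaw :=
  continuous_iff_seqContinuous.2 fun u x hu =>
    ProbabilityMeasure.tendsto_iff_forall_integral_tendsto.2 (D.law_weakly_continuous u x hu)

theorem ae_law_eval_zero_eq [MeasurableSingletonClass E] (x : E) : ∀ᵐ ω ∂(D.law x), ω 0 = x := by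
  have := D.law_isProbabilityMeasure x
  have heval : Measurable fun ω : Trajectory E => ω 0 :=
    measurable_iff_comap_le.2 <| le_iSup (fun s : ℝ≥0 =>
      MeasurableSpace.comap (fun ω : Trajectory E => ω s) inferInstance) 0
  have hstart : D.law x {ω | ω 0 = x} = 1 := by
    simpa [cylinderMass] using
      D.law_isPathLaw x {x} [] (measurableSet_singleton x) (by simp) (by simp)
  exact (prob_compl_eq_zero_iff (heval (measurableSet_singleton x))).2 hstart

variable {c : ℝ} {m : E → E → ℝ}

theorem le_G [MeasurableSingletonClass E] (hm : IsLSCPseudometric m) (hc0 : 0 ≤ c) (hc1 : c ≤ 1) :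
    m ≤ D.G c m := by
  intro x y
  have := D.law_isProbabilityMeasure x
  have := D.law_isProbabilityMeasure y
  have hfin := (hm.discountedUniform hc0 hc1).etransportCost_ne_top (D.law x) (D.law y)
  refine (ENNReal.ofReal_le_iff_le_toReal hfin).1 <|
    le_etransportCost_of_ae (D.ae_law_eval_zero_eq x) (D.ae_law_eval_zero_eq y) ?_
  rintro ω rfl ω' rfl
  exact ENNReal.ofReal_le_ofReal (le_discountedUniform hm hc0 hc1 ω ω')

variable [PolishSpace E] [BorelSpace E]

theorem isLSCPseudometric_G (hm : IsLSCPseudometric m) (hc0 : 0 ≤ c) (hc1 : c ≤ 1) :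
    IsLSCPseudometric (D.G c m) := by
  have := polishSpace_continuousMap ℝ≥0 E
  have := borelSpace_trajectory E
  have hcost := (hm.discountedUniform hc0 hc1).transportCost.comap D.continuous_probLaw
  exact hcost

theorem G_iSup {ms : ℕ → E → E → ℝ} (hms : ∀ n, IsLSCPseudometric (ms n)) (hmono : Monotone ms)
    (hc0 : 0 ≤ c) (hc1 : c ≤ 1) (x y : E) :
    D.G c (fun x y => ⨆ n, ms n x y) x y = ⨆ n, D.G c (ms n) x y := by
  have := polishSpace_continuousMap ℝ≥0 E
  have := borelSpace_trajectory E
  have hU n := (hms n).discountedUniform hc0 hc1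
  have hU_mono : Monotone fun n => discountedUniform (E := E) c (ms n) := fun _ j hij =>
    discountedUniform_mono (hms j) hc0 hc1 (hmono hij)
  calc D.G c (fun x y => ⨆ n, ms n x y) x y
      = transportCost (fun ω ω' => ⨆ n, discountedUniform c (ms n) ω ω') (D.probLaw x)
          (D.probLaw y) :=
        congrArg (transportCost · (D.law x) (D.law y)) <|
          funext₂ (discountedUniform_iSup hms hc0 hc1)
    _ = ⨆ n, transportCost (discountedUniform c (ms n)) (D.probLaw x) (D.probLaw y) :=
        IsLSCPseudometric.transportCost_iSup hU hU_mono (D.probLaw x) (D.probLaw y)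

variable {obs : E → ℝ}

theorem isLSCPseudometric_d (hobs : Continuous obs) (hobs01 : ∀ x, obs x ∈ Set.Icc (0 : ℝ) 1)
    (hc0 : 0 ≤ c) (hc1 : c ≤ 1) (n : ℕ) : IsLSCPseudometric (D.d obs c n) := by
  induction n with
  | zero => exact isLSCPseudometric_abs_sub hobs hobs01
  | succ n ih => exact D.isLSCPseudometric_G ih hc0 hc1

theorem monotone_d (hobs : Continuous obs) (hobs01 : ∀ x, obs x ∈ Set.Icc (0 : ℝ) 1)
    (hc0 : 0 ≤ c) (hc1 : c ≤ 1) : Monotone (D.d obs c) :=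
  monotone_nat_of_le_succ fun n =>
    D.le_G (D.isLSCPseudometric_d hobs hobs01 hc0 hc1 n) hc0 hc1

theorem isLSCPseudometric_dBar (hobs : Continuous obs) (hobs01 : ∀ x, obs x ∈ Set.Icc (0 : ℝ) 1)
    (hc0 : 0 ≤ c) (hc1 : c ≤ 1) : IsLSCPseudometric (D.dBar obs c) :=
  .iSup (D.isLSCPseudometric_d hobs hobs01 hc0 hc1)

theorem G_dBar (hobs : Continuous obs) (hobs01 : ∀ x, obs x ∈ Set.Icc (0 : ℝ) 1)
    (hc0 : 0 ≤ c) (hc1 : c ≤ 1) : D.G c (D.dBar obs c) = D.dBar obs c := by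
  have hd := D.isLSCPseudometric_d hobs hobs01 hc0 hc1
  have hmono := D.monotone_d hobs hobs01 hc0 hc1
  ext x y
  calc D.G c (D.dBar obs c) x y = ⨆ n, D.d obs c (n + 1) x y := D.G_iSup hd hmono hc0 hc1 x y
    _ = D.dBar obs c x y := Monotone.ciSup_comp_tendsto_atTop_of_linearOrder
        (fun _ _ hij => hmono hij x y) (tendsto_add_atTop_nat 1)

end Diffusion

theorem mainTheorem1_general {E : Type*} [TopologicalSpace E] [PolishSpace E] [MeasurableSpace E]
    [BorelSpace E] (D : Diffusion E) {obs : E → ℝ} (hobs : Continuous obs)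
    (hobs01 : ∀ x, obs x ∈ Set.Icc (0 : ℝ) 1) {c : ℝ} (hc0 : 0 ≤ c) (hc1 : c ≤ 1) :
    (∀ n, IsLSCPseudometric (D.d obs c n)) ∧ IsLSCPseudometric (D.dBar obs c) ∧
      D.G c (D.dBar obs c) = D.dBar obs c :=
  ⟨D.isLSCPseudometric_d hobs hobs01 hc0 hc1, D.isLSCPseudometric_dBar hobs hobs01 hc0 hc1,
    D.G_dBar hobs hobs01 hc0 hc1⟩

end DiffusionMetric

theorem mainTheorem1 {E : Type*} [TopologicalSpace E] [LocallyCompactSpace E] [T2Space E]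
    [SecondCountableTopology E] [MeasurableSpace E] [BorelSpace E]
    (D : DiffusionMetric.Diffusion E)
    (obs : E → ℝ) (hobs : Continuous obs) (hobs01 : ∀ x, obs x ∈ Set.Icc (0 : ℝ) 1)
    (c : ℝ) (hc0 : 0 < c) (hc1 : c < 1) :
    (∀ n, DiffusionMetric.IsLSCPseudometric (D.d obs c n)) ∧
      DiffusionMetric.IsLSCPseudometric (D.dBar obs c) ∧
      D.G c (D.dBar obs c) = D.dBar obs c := by
  have := DiffusionMetric.polishSpace_of_weaklyLocallyCompactSpace E
  exact DiffusionMetric.mainTheorem1_general D hobs hobs01 hc0.le hc1.le
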